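/- All path and mapping spaces carry the compact-open topology; write $I=[0,1]$ and $\Delta_2=\{(s,t)\in\mathbb{R}^2 : s,t\ge 0,\ s+t\le 1\}$. Let $X$ be a topological space. A path $\alpha\colon I\to X$ is *well-ended* if for every open neighborhood $U$ of $\alpha$ in the space of all paths in $X$ there are open neighborhoods $V_0$ of $\alpha(0)$ and $V_1$ of $\alpha(1)$ such that for all $a\in V_0$, $b\in V_1$ there is a path $\beta\in U$ with $\beta(0)=a$ and $\beta(1)=b$; it is *locally well-ended* if moreover $\beta$ can always be chosen well-ended. The space $X$ is *locally wep-connected* if every two points of $X$ can be joined by a locally well-ended path. A continuous map $p\colon Y\to X$ is a *semicovering* of $X$ if it is a local homeomorphism and, for every $y\in Y$, composition with $p$ is a homeomorphism from the space of paths in $Y$ starting at $y$ onto the space of paths in $X$ starting at $p(y)$, and also from the space of continuous maps $\Delta_2\to Y$ sending the edge $\{s=0\}$ to $y$ onto the space of continuous maps $\Delta_2\to X$ sending that edge to $p(y)$. It is *connected* if $Y$ is non-empty and path connected. A *universal semicovering* of $X$ is a connected semicovering $p\colon Y\to X$ such that for every connected semicovering $q\colon Z\to X$ there is a continuous map $f\colon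 Y\to Z$ with $q\circ f=p$. Let $\pi_1^\tau(X,x_0)$ be the fundamental group with the finest group topology for which the map from the loop space $\Omega(X,x_0)$ to $\pi_1(X,x_0)$ sending a loop to its homotopy class is continuous. **Corollary.** Let $X$ be a locally wep-connected space and $x_0\in X$. Then $X$ has a universal semicovering if and only if there is an open subgroup $S$ of $\pi_1^\tau(X,x_0)$ such that for every open subgroup $H$ of $\pi_1^\tau(X,x_0)$ there is a $g\in\pi_1^\tau(X,x_0)$ with $gSg^{-1}\subseteq H$. -/

import Mathlib

/-! Path spaces, semicoverings, local wep-connectedness and the topological fundamental group. -/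

namespace Semicov

open unitInterval
open scoped Topology

universe u

section Lifting

variable {X Y : Type*} [TopologicalSpace X] [TopologicalSpace Y]

/-- The space of paths in `Y` starting at `y`, a subspace of the space `C(I, Y)` of all paths,
which carries the compact-open topology. -/
abbrev PathsFrom (y : Y) : Type _ := {α : C(I, Y) // α 0 = y}

/-- Composition with `p`, from paths starting at `y` to paths starting at `p y`. -/
def pathsFromMap (p : C(Y, X)) (y : Y) (α : PathsFrom y) : PathsFrom (p y) :=
  ⟨p.comp α.1, congrArg p α.2⟩

/-- The 2-simplex `{(s, t) | 0 ≤ s, 0 ≤ t, s + t ≤ 1}`. -/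
abbrev Triangle : Type := {z : ℝ × ℝ // 0 ≤ z.1 ∧ 0 ≤ z.2 ∧ z.1 + z.2 ≤ 1}

/-- The space of maps from the 2-simplex to `Y` which are constant with value `y` on the edge
opposite to the vertex `(1, 0)`, with the compact-open topology. Such a map is a homotopy,
relative to the endpoints, between the paths it induces on the other two edges, both directed
from the first edge to `(1, 0)`. -/
abbrev HomotopiesFrom (y : Y) : Type _ :=
  {φ : C(Triangle, Y) // ∀ z : Triangle, z.1.1 = 0 → φ z = y}

/-- Composition with `p`, from homotopies at `y` to homotopies at `p y`. -/
def homotopiesFromMap (p : C(Y, X)) (y : Y) (φ : HomotopiesFrom y) : HomotopiesFrom (p y) :=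
  ⟨p.comp φ.1, fun z hz => congrArg p (φ.2 z hz)⟩

/-- A map has continuous lifting of paths if composition with it is a homeomorphism from paths
starting at `y` to paths starting at `p y`, for every `y`. -/
def HasContinuousPathLifting (p : C(Y, X)) : Prop :=
  ∀ y : Y, IsHomeomorph (pathsFromMap p y)

/-- The analogous condition for homotopies of paths. -/
def HasContinuousHomotopyLifting (p : C(Y, X)) : Prop :=
  ∀ y : Y, IsHomeomorph (homotopiesFromMap p y)

/-- A semicovering is a local homeomorphism with continuous lifting of paths and homotopies. -/
structure IsSemicovering (p : C(Y, X)) : Prop where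
  isLocalHomeomorph : IsLocalHomeomorph p
  pathLifting : HasContinuousPathLifting p
  homotopyLifting : HasContinuousHomotopyLifting p

/-- A semicovering is connected if its total space is non-empty and path connected. -/
structure IsConnectedSemicovering (p : C(Y, X)) : Prop extends IsSemicovering p where
  pathConnected : PathConnectedSpace Y

end Lifting

/-- A universal semicovering of `X`: a connected semicovering admitting a morphism of semicoverings
(a continuous map over `X`) to every connected semicovering of `X`. -/
structure IsUniversalSemicovering {X Y : Type u} [TopologicalSpace X] [TopologicalSpace Y]
    (p : C(Y, X)) : Prop extends IsConnectedSemicovering p where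
  exists_hom : ∀ (Z : Type u) [TopologicalSpace Z] (q : C(Z, X)),
    IsConnectedSemicovering q → ∃ f : C(Y, Z), q.comp f = p

/-- `X` has a universal semicovering. -/
def HasUniversalSemicovering (X : Type u) [TopologicalSpace X] : Prop :=
  ∃ (Y : Type u) (_ : TopologicalSpace Y) (p : C(Y, X)), IsUniversalSemicovering p

section Wep

variable {X : Type*} [TopologicalSpace X]

/-- Every neighborhood of `α` in the path space contains paths from `a` to `b` for all `a` near
the start and all `b` near the end of `α`. -/
def IsWellEnded (α : C(I, X)) : Prop :=
  ∀ U : Set C(I, X), IsOpen U → α ∈ U →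
    ∃ V₀ V₁ : Set X, IsOpen V₀ ∧ IsOpen V₁ ∧ α 0 ∈ V₀ ∧ α 1 ∈ V₁ ∧
      ∀ a ∈ V₀, ∀ b ∈ V₁, ∃ β ∈ U, β 0 = a ∧ β 1 = b

/-- As `IsWellEnded`, but the connecting paths can moreover be chosen well-ended. -/
def IsLocallyWellEnded (α : C(I, X)) : Prop :=
  ∀ U : Set C(I, X), IsOpen U → α ∈ U →
    ∃ V₀ V₁ : Set X, IsOpen V₀ ∧ IsOpen V₁ ∧ α 0 ∈ V₀ ∧ α 1 ∈ V₁ ∧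
      ∀ a ∈ V₀, ∀ b ∈ V₁, ∃ β ∈ U, IsWellEnded β ∧ β 0 = a ∧ β 1 = b

/-- Any two points of `X` can be joined by a locally well-ended path. -/
def LocallyWepConnected (X : Type*) [TopologicalSpace X] : Prop :=
  ∀ a b : X, ∃ α : C(I, X), IsLocallyWellEnded α ∧ α 0 = a ∧ α 1 = b

end Wep

section FundamentalGroup

variable {X : Type*} [TopologicalSpace X]

/-- The map from the loop space at `x` (with the compact-open topology) to the fundamental group,
sending a loop to its homotopy class. -/
def loopClass (x : X) (γ : Path x x) : FundamentalGroup X x :=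
  FundamentalGroup.fromPath (Path.Homotopic.Quotient.mk γ)

/-- The topology of the quasitopological fundamental group: the quotient topology from the
loop space. -/
@[reducible]
def quasiTopology (x : X) : TopologicalSpace (FundamentalGroup X x) :=
  TopologicalSpace.coinduced (loopClass x) (inferInstanceAs (TopologicalSpace (Path x x)))

/-- The topology of the topological fundamental group: the finest group topology on the
fundamental group that is coarser than the quotient topology from the loop space. -/
noncomputable def tauTopology (x : X) : GroupTopology (FundamentalGroup X x) :=
  @GroupTopology.coinduced _ _ (quasiTopology x) _ id

/-- A subgroup of the fundamental group that is open in the topological fundamental group. -/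
def IsOpenSubgroup (x : X) (H : Subgroup (FundamentalGroup X x)) : Prop :=
  IsOpen[(tauTopology x).toTopologicalSpace] (H : Set (FundamentalGroup X x))

end FundamentalGroup

end Semicov

/-! Connected semicoverings are compared with open subgroups of the fundamental group. A
semicovering gives the stabilizer of a point over `x₀` (`liftStabilizer`), which is open; an open
subgroup `H` gives the space of paths from `x₀` modulo `H` (`SubgroupCover H`), which is a connected
semicovering. A morphism into `SubgroupCover H` forces a conjugate of the stabilizer of its source
into `H` (`exists_conj_mem_of_hom`); conversely, a conjugate of `S` inside a stabilizer of `q` gives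
a morphism from `SubgroupCover S` to `q` (`exists_hom_of_conj_mem`). So the stabilizer of a
universal semicovering is a suitable `S`, and the cover of a suitable `S` is universal.

Two points need work. For subgroups, openness can be tested in the loop space
(`isOpenSubgroup_iff`). And `proj H` must be a semicovering: openness of `H` makes the
identification of paths clopen among pairs with a common endpoint, and local wep-connectedness
provides representatives at which the quotient map carries neighborhoods to neighborhoods
(`image_mk_mem_nhds`). -/

namespace Semicov

open unitInterval Filter Set
open scoped Topology

/-! ### Open subgroups of the topological fundamental group. -/

section FundamentalGroupTopology

variable {X : Type*} [TopologicalSpace X] {x : X}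

theorem loopClass_trans (γ δ : Path x x) :
    loopClass x (γ.trans δ) = loopClass x δ * loopClass x γ := rfl

theorem loopClass_symm (γ : Path x x) : loopClass x γ.symm = (loopClass x γ)⁻¹ := rfl

theorem loopClass_surjective : Function.Surjective (loopClass x) :=
  fun g => Path.Homotopic.Quotient.mk_surjective g

theorem loopClass_eq_of_homotopic {γ δ : Path x x} (h : γ.Homotopic δ) :
    loopClass x γ = loopClass x δ :=
  Path.Homotopic.Quotient.eq.2 h

theorem loopClass_eq_iff {γ δ : Path x x} :
    loopClass x γ = loopClass x δ ↔ γ.Homotopic δ :=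
  Path.Homotopic.Quotient.eq

theorem isOpen_setOf_mul_loopClass_mul_mem {H : Subgroup (FundamentalGroup X x)}
    (hH : IsOpen {γ : Path x x | loopClass x γ ∈ H}) (a b : FundamentalGroup X x) :
    IsOpen {γ : Path x x | a * loopClass x γ * b ∈ H} := by
  obtain ⟨α, rfl⟩ := loopClass_surjective a
  obtain ⟨β, rfl⟩ := loopClass_surjective b
  have hc : Continuous fun γ : Path x x => β.trans (γ.trans α) :=
    continuous_const.path_trans (continuous_id.path_trans continuous_const)
  exact hH.preimage hc

theorem isClopen_setOf_loopClass_mem {H : Subgroup (FundamentalGroup X x)}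
    (hH : IsOpen {γ : Path x x | loopClass x γ ∈ H}) :
    IsClopen {γ : Path x x | loopClass x γ ∈ H} := by
  refine ⟨⟨isOpen_iff_mem_nhds.2 fun δ hδ => ?_⟩, hH⟩
  filter_upwards [(isOpen_setOf_mul_loopClass_mul_mem hH (loopClass x δ)⁻¹ 1).mem_nhds
    (by simp only [Set.mem_ofPred_eq, inv_mul_cancel, one_mul, H.one_mem])] with γ hγ hγH
  simp only [Set.mem_ofPred_eq, mul_one] at hγ hγH
  have h := H.mul_mem hγH (H.inv_mem hγ)
  rw [mul_inv_rev, inv_inv, mul_inv_cancel_left] at h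
  exact hδ h

/-- The group topology induced by the action on a coset space, considered as discrete. -/
def cosetTopology {G : Type*} [Group G] (H : Subgroup G) : GroupTopology G :=
  letI : TopologicalSpace (G ⧸ H) := ⊥
  haveI : DiscreteTopology (G ⧸ H) := ⟨rfl⟩
  letI t : TopologicalSpace G := .induced (fun (g : G) (c : G ⧸ H) => g • c) inferInstance
  have hev (c : G ⧸ H) : Continuous fun g : G => g • c :=
    (continuous_apply c).comp continuous_induced_dom
  have hloc (g : G) (c : G ⧸ H) : ∀ᶠ g' in 𝓝 g, g' • c = g • c :=
    (hev c).continuousAt.eventually_mem (mem_nhds_discrete.2 (mem_singleton _))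
  { toTopologicalSpace := t
    toIsTopologicalGroup :=
      { continuous_mul := by
          refine continuous_induced_rng.2 (continuous_pi fun c => continuous_iff_continuousAt.2 ?_)
          rintro ⟨g, h⟩
          refine tendsto_nhds_of_eventually_eq ?_
          rw [nhds_prod_eq]
          filter_upwards [(hloc g (h • c)).prod_mk (hloc h c)] with p hp
          simp only [Function.comp_apply, mul_smul, hp.2, hp.1]
        continuous_inv := by
          refine continuous_induced_rng.2 (continuous_pi fun c => continuous_iff_continuousAt.2 ?_)
          intro g
          refine tendsto_nhds_of_eventually_eq ?_
          filter_upwards [hloc g (g⁻¹ • c)] with g' hg'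
          simp only [Function.comp_apply]
          rw [inv_smul_eq_iff, hg', smul_inv_smul] } }

theorem isOpen_cosetTopology {G : Type*} [Group G] (H : Subgroup G) :
    IsOpen[(cosetTopology H).toTopologicalSpace] (H : Set G) := by
  let _ : TopologicalSpace (G ⧸ H) := ⊥
  have _ : DiscreteTopology (G ⧸ H) := ⟨rfl⟩
  refine isOpen_induced_iff.2 ⟨{f | f ((1 : G) : G ⧸ H) = ((1 : G) : G ⧸ H)}, ?_, ?_⟩
  · exact (isOpen_discrete {((1 : G) : G ⧸ H)}).preimage
      (continuous_apply (A := fun _ : G ⧸ H => G ⧸ H) ((1 : G) : G ⧸ H))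
  · ext g
    simp only [mem_preimage, mem_ofPred_eq, SetLike.mem_coe]
    rw [MulAction.Quotient.smul_coe, eq_comm, QuotientGroup.eq]
    simp

/-- For the converse, `cosetTopology H` is a group topology in which `H`, the stabilizer of the
trivial coset, is open. It is coarser than the quotient topology because the loops carrying one
coset to another form an open set, so the finest such group topology refines it. -/
theorem isOpenSubgroup_iff {H : Subgroup (FundamentalGroup X x)} :
    IsOpenSubgroup x H ↔ IsOpen {γ : Path x x | loopClass x γ ∈ H} := by
  constructor
  · intro h
    have hc := @GroupTopology.coinduced_continuous _ _ (quasiTopology x) _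
      (id : FundamentalGroup X x → FundamentalGroup X x)
    exact @IsOpen.preimage _ _ (quasiTopology x) (tauTopology x).toTopologicalSpace _ hc _ h
  · intro h
    have hle : tauTopology x ≤ cosetTopology H := by
      refine sInf_le ?_
      let _ : TopologicalSpace (FundamentalGroup X x ⧸ H) := ⊥
      have _ : DiscreteTopology (FundamentalGroup X x ⧸ H) := ⟨rfl⟩
      change TopologicalSpace.coinduced id (quasiTopology x) ≤ _
      refine (@coinduced_id _ (quasiTopology x)).le.trans ?_
      refine continuous_iff_coinduced_le.1 ?_
      let _ := (cosetTopology H).toTopologicalSpace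
      refine continuous_induced_rng.2 (continuous_pi fun c => ?_)
      refine continuous_discrete_rng.2 fun d => ?_
      induction c using QuotientGroup.induction_on with | H a => ?_
      induction d using QuotientGroup.induction_on with | H b => ?_
      have e : {γ : Path x x | loopClass x γ • (a : FundamentalGroup X x ⧸ H) = b} =
          {γ | b⁻¹ * loopClass x γ * a ∈ H} := by
        ext γ
        simp only [mem_ofPred_eq]
        rw [MulAction.Quotient.smul_coe, eq_comm, QuotientGroup.eq, smul_eq_mul, ← mul_assoc]
      exact (congrArg IsOpen e).mpr (isOpen_setOf_mul_loopClass_mul_mem h b⁻¹ a)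
    exact hle _ (isOpen_cosetTopology H)

end FundamentalGroupTopology

/-! ### Lifting paths and homotopies; stabilizers of fibre points. -/

section Lifts

variable {X Y : Type*} [TopologicalSpace X] [TopologicalSpace Y] {q : C(Y, X)}

theorem HasContinuousPathLifting.exists_lift (hq : HasContinuousPathLifting q) {x : X} {y : Y}
    (hy : q y = x) : ∃ L : C(PathsFrom x, C(I, Y)), ∀ α : PathsFrom x,
      q.comp (L α) = α.1 ∧ L α 0 = y := by
  subst hy
  refine ⟨⟨fun α => ((hq y).homeomorph.symm α).1, by fun_prop⟩, fun α => ⟨?_, ?_⟩⟩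
  · exact congrArg Subtype.val ((hq y).homeomorph.apply_symm_apply α)
  · exact ((hq y).homeomorph.symm α).2

theorem HasContinuousPathLifting.eq_of_comp_eq (hq : HasContinuousPathLifting q) {Γ Δ : C(I, Y)}
    (h : q.comp Γ = q.comp Δ) (h₀ : Γ 0 = Δ 0) : Γ = Δ :=
  congrArg Subtype.val <| (hq (Δ 0)).injective (a₁ := ⟨Γ, h₀⟩) (a₂ := ⟨Δ, rfl⟩) <|
    Subtype.ext h

/-- The radial segment from the origin to a point of the triangle. -/
def radius : C(Triangle × I, Triangle) where
  toFun w := ⟨(w.2.1 * w.1.1.1, w.2.1 * w.1.1.2), by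
    obtain ⟨⟨z, h₁, h₂, h₃⟩, r, h₄, h₅⟩ := w
    refine ⟨mul_nonneg h₄ h₁, mul_nonneg h₄ h₂, ?_⟩
    change r * z.1 + r * z.2 ≤ 1
    nlinarith⟩
  continuous_toFun := by fun_prop

instance : LocallyCompactSpace Triangle := by
  have h : IsClosed {z : ℝ × ℝ | 0 ≤ z.1 ∧ 0 ≤ z.2 ∧ z.1 + z.2 ≤ 1} :=
    (isClosed_Ici.preimage continuous_fst).inter
      ((isClosed_Ici.preimage continuous_snd).inter
        (isClosed_Iic.preimage (continuous_fst.add continuous_snd)))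
  exact h.isClosedEmbedding_subtypeVal.locallyCompactSpace

/-- The restriction of a homotopy to a radial segment. -/
def homotopyRadius {x : X} (w : HomotopiesFrom x × Triangle) : PathsFrom x :=
  ⟨w.1.1.comp (radius.curry w.2), w.1.2 _ (zero_mul _)⟩

theorem continuous_homotopyRadius {x : X} :
    Continuous (homotopyRadius : HomotopiesFrom x × Triangle → PathsFrom x) :=
  Continuous.subtype_mk
    ((continuous_subtype_val.comp continuous_fst).compCM
      (radius.curry.continuous.comp continuous_snd)) _

theorem radius_one (z : Triangle) : radius (z, 1) = z := by
  ext <;> simp [radius]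

/-- The triangle is star-shaped about the origin, which lies on the collapsed edge. Lifting each
radial segment and taking its endpoint lifts the homotopy, continuously in all variables. -/
theorem HasContinuousPathLifting.hasContinuousHomotopyLifting (hq : HasContinuousPathLifting q) :
    HasContinuousHomotopyLifting q := by
  intro y
  obtain ⟨L, hL⟩ := hq.exists_lift (rfl : q y = q y)
  let G : C(HomotopiesFrom (q y), C(Triangle, Y)) := ContinuousMap.curry
    ⟨fun w => L (homotopyRadius w) 1,
      (L.continuous.comp continuous_homotopyRadius).eval_const 1⟩
  have hG (φ : HomotopiesFrom (q y)) (z : Triangle) (hz : z.1.1 = 0) : G φ z = y := by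
    -- A radius towards the collapsed edge stays in it, so the path to be lifted is constant.
    have : L (homotopyRadius (φ, z)) = ContinuousMap.const I y := by
      refine hq.eq_of_comp_eq ?_ (hL _).2
      rw [(hL _).1]
      ext r
      exact φ.2 _ (by simp [radius, hz])
    exact congrArg (fun Γ : C(I, Y) => Γ 1) this
  rw [isHomeomorph_iff_exists_inverse]
  refine ⟨((ContinuousMap.continuous_postcomp q).comp continuous_subtype_val).subtype_mk _,
    fun φ => ⟨G φ, hG φ⟩, fun φ => ?_, fun φ => ?_, G.continuous.subtype_mk _⟩
  · refine Subtype.ext (ContinuousMap.ext fun z => ?_)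
    have : L (homotopyRadius (homotopiesFromMap q y φ, z)) = (homotopyRadius (φ, z)).1 :=
      hq.eq_of_comp_eq (hL _).1 ((hL _).2.trans (homotopyRadius (φ, z)).2.symm)
    change L (homotopyRadius (homotopiesFromMap q y φ, z)) 1 = _
    rw [this]
    exact congrArg φ.1 (radius_one z)
  · refine Subtype.ext (ContinuousMap.ext fun z => ?_)
    change (q.comp (L (homotopyRadius (φ, z)))) 1 = _
    rw [(hL _).1]
    exact congrArg φ.1 (radius_one z)

/-- The lift of the path `α` along `q` starting at `y` exists and ends at `w`. -/
def LiftEnds (q : C(Y, X)) (y : Y) (α : C(I, X)) (w : Y) : Prop :=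
  ∃ Γ : C(I, Y), q.comp Γ = α ∧ Γ 0 = y ∧ Γ 1 = w

namespace LiftEnds

variable {a b c : X} {y w v : Y}

theorem refl (y : Y) (h : q y = a) : LiftEnds q y (Path.refl a).toContinuousMap y :=
  ⟨ContinuousMap.const I y, by ext; exact h, rfl, rfl⟩

theorem symm {α : Path a b} (h : LiftEnds q y α.toContinuousMap w) :
    LiftEnds q w α.symm.toContinuousMap y := by
  obtain ⟨Γ, h, rfl, rfl⟩ := h
  refine ⟨(Path.symm ⟨Γ, rfl, rfl⟩).toContinuousMap, ?_, by simp, by simp⟩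
  ext t
  exact DFunLike.congr_fun h (σ t)

theorem trans {α : Path a b} {β : Path b c} (h₁ : LiftEnds q y α.toContinuousMap w)
    (h₂ : LiftEnds q w β.toContinuousMap v) :
    LiftEnds q y (α.trans β).toContinuousMap v := by
  obtain ⟨Γ, h₁, rfl, rfl⟩ := h₁
  obtain ⟨Δ, h₂, h, rfl⟩ := h₂
  refine ⟨(Path.trans (y := Γ 1) ⟨Γ, rfl, rfl⟩ ⟨Δ, h, rfl⟩).toContinuousMap, ?_, by simp, by simp⟩
  ext t
  have e₁ (t : I) : q (Γ t) = α t := DFunLike.congr_fun h₁ t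
  have e₂ (t : I) : q (Δ t) = β t := DFunLike.congr_fun h₂ t
  change q (Path.trans _ _ t) = α.trans β t
  rw [Path.trans_apply, Path.trans_apply]
  split_ifs
  · exact e₁ _
  · exact e₂ _

theorem unique (hq : HasContinuousPathLifting q) {α : C(I, X)} (h₁ : LiftEnds q y α w)
    (h₂ : LiftEnds q y α v) : w = v := by
  obtain ⟨Γ, h₁, h₁', rfl⟩ := h₁
  obtain ⟨Δ, h₂, h₂', rfl⟩ := h₂
  rw [hq.eq_of_comp_eq (h₁.trans h₂.symm) (h₁'.trans h₂'.symm)]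

/-- The endpoints of the lifted stages of the homotopy move continuously in one fibre. Local
injectivity of `q` makes them locally constant, hence constant on `I`. -/
theorem congr_homotopic (hl : IsLocalHomeomorph q) (hq : HasContinuousPathLifting q)
    {α β : Path a b} (hαβ : α.Homotopic β) (h : LiftEnds q y α.toContinuousMap w) :
    LiftEnds q y β.toContinuousMap w := by
  obtain ⟨F⟩ := hαβ
  have hy : q y = a := by
    obtain ⟨Γ, h, rfl, -⟩ := h
    exact (DFunLike.congr_fun h 0).trans α.source
  obtain ⟨L, hL⟩ := hq.exists_lift hy
  let E (t : I) : Y := L ⟨(F.eval t).toContinuousMap, (F.eval t).source⟩ 1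
  have hE : Continuous E := by
    refine Continuous.eval_const (L.continuous.comp (Continuous.subtype_mk ?_ _)) 1
    exact ContinuousMap.continuous_of_continuous_uncurry _ F.continuous
  have hqE (t : I) : q (E t) = b :=
    (DFunLike.congr_fun (hL ⟨(F.eval t).toContinuousMap, (F.eval t).source⟩).1 1).trans
      (F.eval t).target
  have hloc : IsLocallyConstant E := by
    refine (IsLocallyConstant.iff_isOpen_fiber_apply).2 fun t => ?_
    exact hl.isLocallyInjective.isOpen_eqLocus hE continuous_const
      (funext fun s => (hqE s).trans (hqE t).symm)
  have h01 : E 0 = E 1 := hloc.apply_eq_of_isPreconnected isPreconnected_univ trivial trivial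
  have h0 : LiftEnds q y α.toContinuousMap (E 0) :=
    ⟨L _, (hL _).1.trans (by simp), (hL _).2, rfl⟩
  rw [h.unique hq h0, h01]
  exact ⟨L _, (hL _).1.trans (by simp), (hL _).2, rfl⟩

theorem comp {Z : Type*} [TopologicalSpace Z] {p : C(Z, X)} {f : C(Y, Z)} (hf : p.comp f = q)
    {α : C(I, X)} (h : LiftEnds q y α w) : LiftEnds p (f y) α (f w) := by
  obtain ⟨Γ, rfl, rfl, rfl⟩ := h
  exact ⟨f.comp Γ, by rw [← hf]; rfl, rfl, rfl⟩

end LiftEnds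

theorem HasContinuousPathLifting.exists_liftEnds (hq : HasContinuousPathLifting q) {x : X} {y : Y}
    (hy : q y = x) {x' : X} (α : Path x x') :
    ∃ w, q w = x' ∧ LiftEnds q y α.toContinuousMap w := by
  obtain ⟨L, hL⟩ := hq.exists_lift hy
  refine ⟨L ⟨α.toContinuousMap, α.source⟩ 1, ?_, _, (hL _).1, (hL _).2, rfl⟩
  exact (DFunLike.congr_fun (hL ⟨α.toContinuousMap, α.source⟩).1 1).trans α.target

theorem LiftEnds.eq_of_trans_symm (hq : HasContinuousPathLifting q) {x x' : X} {y u v : Y}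
    {a b : Path x x'} (h : LiftEnds q y (a.trans b.symm).toContinuousMap y)
    (ha : LiftEnds q y a.toContinuousMap u) (hb : LiftEnds q y b.toContinuousMap v) : u = v := by
  have hu : q u = x' := by
    obtain ⟨Γ, hΓ, -, rfl⟩ := ha
    exact (DFunLike.congr_fun hΓ 1).trans a.target
  obtain ⟨w, -, hw⟩ := hq.exists_liftEnds hu b.symm
  obtain rfl := (ha.trans hw).unique hq h
  have h' := hw.symm
  rw [Path.symm_symm] at h'
  exact h'.unique hq hb

/-- The classes of the loops which lift to loops at `y`. -/
def liftStabilizer (_hq : IsSemicovering q) {x : X} {y : Y} (hy : q y = x) :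
    Subgroup (FundamentalGroup X x) where
  carrier := {g | ∃ γ, loopClass x γ = g ∧ LiftEnds q y γ.toContinuousMap y}
  one_mem' := ⟨Path.refl x, rfl, .refl y hy⟩
  mul_mem' := by
    rintro _ _ ⟨γ, rfl, hγ⟩ ⟨δ, rfl, hδ⟩
    exact ⟨δ.trans γ, rfl, hδ.trans hγ⟩
  inv_mem' := by
    rintro _ ⟨γ, rfl, hγ⟩
    exact ⟨γ.symm, rfl, hγ.symm⟩

theorem loopClass_mem_liftStabilizer (hq : IsSemicovering q) {x : X} {y : Y} (hy : q y = x)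
    {γ : Path x x} :
    loopClass x γ ∈ liftStabilizer hq hy ↔ LiftEnds q y γ.toContinuousMap y := by
  refine ⟨?_, fun h => ⟨γ, rfl, h⟩⟩
  rintro ⟨δ, h, hδ⟩
  exact hδ.congr_homotopic hq.1 hq.2 (loopClass_eq_iff.1 h)

theorem isOpenSubgroup_liftStabilizer (hq : IsSemicovering q) {x : X} {y : Y} (hy : q y = x) :
    IsOpenSubgroup x (liftStabilizer hq hy) := by
  rw [isOpenSubgroup_iff]
  simp only [loopClass_mem_liftStabilizer]
  obtain ⟨L, hL⟩ := hq.pathLifting.exists_lift hy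
  let E (γ : Path x x) : Y := L ⟨γ.toContinuousMap, γ.source⟩ 1
  have hE : Continuous E :=
    Continuous.eval_const
      (L.continuous.comp (Continuous.subtype_mk continuous_induced_dom _)) 1
  have hqE (γ : Path x x) : q (E γ) = x :=
    (DFunLike.congr_fun (hL ⟨γ.toContinuousMap, γ.source⟩).1 1).trans γ.target
  have hlift (γ : Path x x) : LiftEnds q y γ.toContinuousMap (E γ) := ⟨L _, (hL _).1, (hL _).2, rfl⟩
  convert hq.isLocalHomeomorph.isLocallyInjective.isOpen_eqLocus hE
    continuous_const (funext fun γ => (hqE γ).trans hy.symm) using 1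
  ext γ
  simp only [mem_ofPred_eq]
  exact ⟨fun h => (hlift γ).unique hq.2 h, fun h => h ▸ hlift γ⟩

end Lifts

/-! ### The quotient of the path space by an open subgroup. -/

section SubgroupCover

variable {X : Type*} [TopologicalSpace X] {x₀ : X}

/-- A path, as a point of the space of paths with the same start. -/
def ofPath {x : X} (a : Path x₀ x) : PathsFrom x₀ := ⟨a.toContinuousMap, a.source⟩

/-- A point of the space of paths starting at `x₀`, as a path to its endpoint. -/
def PathsFrom.toPath (α : PathsFrom x₀) : Path x₀ (α.1 1) := ⟨α.1, α.2, rfl⟩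

theorem continuous_ofPath {ι : Type*} [TopologicalSpace ι] {e : ι → X} {a : ∀ i, Path x₀ (e i)}
    (ha : Continuous ↿a) : Continuous fun i => ofPath (a i) :=
  Continuous.subtype_mk (ContinuousMap.continuous_of_continuous_uncurry _ ha) _

theorem continuous_toPath : Continuous ↿(fun α : PathsFrom x₀ => α.toPath) :=
  (continuous_subtype_val.comp continuous_fst).eval continuous_snd

/-- The endpoint of a path. -/
def endpoint : C(PathsFrom x₀, X) := ⟨fun α => α.1 1, by fun_prop⟩

theorem loopClass_trans_symm_mul {x : X} (a b c : Path x₀ x) :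
    loopClass x₀ (b.trans c.symm) * loopClass x₀ (a.trans b.symm) =
      loopClass x₀ (a.trans c.symm) := by
  refine loopClass_eq_iff.2 (Path.Homotopic.Quotient.eq.1 ?_)
  simp only [Path.Homotopic.Quotient.mk_trans, Path.Homotopic.Quotient.mk_symm]
  rw [Path.Homotopic.Quotient.trans_assoc, ← Path.Homotopic.Quotient.trans_assoc _ _
    (Path.Homotopic.Quotient.symm _), Path.Homotopic.Quotient.symm_trans,
    Path.Homotopic.Quotient.refl_trans]

theorem loopClass_trans_symm_self {x : X} (a : Path x₀ x) :
    loopClass x₀ (a.trans a.symm) = 1 :=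
  loopClass_eq_iff.2 (Path.Homotopic.trans_symm a)

theorem loopClass_trans_symm_inv {x : X} (a b : Path x₀ x) :
    (loopClass x₀ (a.trans b.symm))⁻¹ = loopClass x₀ (b.trans a.symm) := by
  rw [← loopClass_symm, Path.trans_symm, Path.symm_symm]

/-- Two paths with the same endpoint are identified if they form a loop whose class
is in the subgroup `H`. -/
def coverSetoid (H : Subgroup (FundamentalGroup X x₀)) : Setoid (PathsFrom x₀) where
  r α β := ∃ h : α.1 1 = β.1 1, loopClass x₀ (α.toPath.trans (β.toPath.cast rfl h).symm) ∈ H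
  iseqv :=
    { refl := fun α => ⟨rfl, by
        rw [Path.cast_rfl_rfl, loopClass_trans_symm_self]; exact H.one_mem⟩
      symm := by
        rintro ⟨α, hα⟩ ⟨β, hβ⟩ ⟨h, h'⟩
        refine ⟨h.symm, ?_⟩
        rw [← H.inv_mem_iff, loopClass_trans_symm_inv] at h'
        exact h'
      trans := by
        rintro ⟨α, hα⟩ ⟨β, hβ⟩ ⟨γ, hγ⟩ ⟨h, h'⟩ ⟨k, k'⟩
        refine ⟨h.trans k, ?_⟩
        let b : Path x₀ (α 1) := ⟨β, hβ, h.symm⟩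
        let c : Path x₀ (α 1) := ⟨γ, hγ, (h.trans k).symm⟩
        let a : Path x₀ (α 1) := ⟨α, hα, rfl⟩
        exact (loopClass_trans_symm_mul a b c) ▸ H.mul_mem k' h' }

/-- The space of paths from `x₀` modulo the subgroup `H`, with the quotient topology. -/
def SubgroupCover (H : Subgroup (FundamentalGroup X x₀)) : Type _ := Quotient (coverSetoid H)

instance (H : Subgroup (FundamentalGroup X x₀)) : TopologicalSpace (SubgroupCover H) :=
  inferInstanceAs (TopologicalSpace (Quotient (coverSetoid H)))

namespace SubgroupCover

variable {H : Subgroup (FundamentalGroup X x₀)}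

/-- The class of a path. -/
def mk (H : Subgroup (FundamentalGroup X x₀)) (α : PathsFrom x₀) : SubgroupCover H :=
  Quotient.mk (coverSetoid H) α

theorem isQuotientMap_mk : Topology.IsQuotientMap (mk H) := isQuotientMap_quot_mk

theorem mk_eq_mk_iff {α β : PathsFrom x₀} : mk H α = mk H β ↔
    ∃ h : α.1 1 = β.1 1, loopClass x₀ (α.toPath.trans (β.toPath.cast rfl h).symm) ∈ H :=
  Quotient.eq (r := coverSetoid H)

theorem mk_ofPath_eq_iff {x : X} {a b : Path x₀ x} :
    mk H (ofPath a) = mk H (ofPath b) ↔ loopClass x₀ (a.trans b.symm) ∈ H := by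
  rw [mk_eq_mk_iff]
  obtain ⟨a, ha, rfl⟩ := a
  exact ⟨fun h => h.2, fun h => ⟨b.target.symm, h⟩⟩

theorem mk_ofPath_eq_of_homotopic {x : X} {a b : Path x₀ x} (h : a.Homotopic b) :
    mk H (ofPath a) = mk H (ofPath b) := by
  rw [mk_ofPath_eq_iff, loopClass_eq_of_homotopic (h.hcomp (.refl b.symm)),
    loopClass_trans_symm_self]
  exact H.one_mem

/-- The projection, sending the class of a path to its endpoint. -/
def proj (H : Subgroup (FundamentalGroup X x₀)) : C(SubgroupCover H, X) where
  toFun := Quotient.lift endpoint fun _ _ h => h.1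
  continuous_toFun := endpoint.continuous.quotient_lift _

/-- The loop formed by two paths with a common endpoint depends continuously on the pair, and the
loops with class in `H` form a clopen set. -/
theorem isClopen_setOf_mk_eq (hH : IsOpenSubgroup x₀ H) :
    IsClopen {e : {e : PathsFrom x₀ × PathsFrom x₀ // e.1.1 1 = e.2.1 1} |
      mk H e.1.1 = mk H e.1.2} := by
  have hc : Continuous fun e : {e : PathsFrom x₀ × PathsFrom x₀ // e.1.1 1 = e.2.1 1} =>
      e.1.1.toPath.trans (e.1.2.toPath.cast rfl e.2).symm := by
    refine Path.continuous_uncurry_iff.1 ?_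
    refine Path.trans_continuous_family (b := fun e : {e : PathsFrom x₀ × PathsFrom x₀ //
      e.1.1 1 = e.2.1 1} => e.1.1.1 1) _ ?_ _ ?_
    · exact continuous_toPath.comp (((continuous_fst.comp continuous_subtype_val).comp
        continuous_fst).prodMk continuous_snd)
    · refine Path.symm_continuous_family _ ?_
      exact continuous_toPath.comp (((continuous_snd.comp continuous_subtype_val).comp
        continuous_fst).prodMk continuous_snd)
  convert (isClopen_setOf_loopClass_mem (isOpenSubgroup_iff.1 hH)).preimage hc using 1
  ext e
  simp only [mem_ofPred_eq, mem_preimage, mk_eq_mk_iff]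
  exact ⟨fun h => h.2, fun h => ⟨e.2, h⟩⟩

theorem eventually_mk_eq (hH : IsOpenSubgroup x₀ H) {α β : PathsFrom x₀} (h : mk H α = mk H β) :
    ∀ᶠ e in 𝓝 α ×ˢ 𝓝 β, e.1.1 1 = e.2.1 1 → mk H e.1 = mk H e.2 := by
  have hαβ : α.1 1 = β.1 1 := congrArg (proj H) h
  have := (isClopen_setOf_mk_eq hH).isOpen.mem_nhds (x := ⟨(α, β), hαβ⟩) h
  rw [nhds_induced, mem_comap, nhds_prod_eq] at this
  obtain ⟨T, hT, hTs⟩ := this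
  filter_upwards [hT] with e he he'
  exact hTs (a := ⟨e, he'⟩) he

theorem eventually_mk_ne (hH : IsOpenSubgroup x₀ H) {α β : PathsFrom x₀} (hαβ : α.1 1 = β.1 1)
    (h : mk H α ≠ mk H β) : ∀ᶠ e in 𝓝 α ×ˢ 𝓝 β, mk H e.1 ≠ mk H e.2 := by
  have := (isClopen_setOf_mk_eq hH).compl.isOpen.mem_nhds (x := ⟨(α, β), hαβ⟩) h
  rw [nhds_induced, mem_comap, nhds_prod_eq] at this
  obtain ⟨T, hT, hTs⟩ := this
  filter_upwards [hT] with e he he'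
  exact hTs (a := ⟨e, congrArg (proj H) he'⟩) he he'

end SubgroupCover

/-! ### Well-targeted paths and the local structure of the projection. -/

/-- Every point near the endpoint of `α` is the endpoint of a path near `α` with the same start. -/
def WellTargeted (α : PathsFrom x₀) : Prop :=
  ∀ U ∈ 𝓝 α, ∀ᶠ b in 𝓝 (α.1 1), ∃ β ∈ U, β.1 1 = b

/-- As `WellTargeted`, but the nearby paths can moreover be chosen well-targeted. -/
def LocallyWellTargeted (α : PathsFrom x₀) : Prop :=
  ∀ U ∈ 𝓝 α, ∀ᶠ b in 𝓝 (α.1 1), ∃ β ∈ U, WellTargeted β ∧ β.1 1 = b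

theorem LocallyWellTargeted.wellTargeted {α : PathsFrom x₀} (h : LocallyWellTargeted α) :
    WellTargeted α := fun U hU =>
  (h U hU).mono fun _ ⟨β, hβ, _, hb⟩ => ⟨β, hβ, hb⟩

/-- Concatenation with a loop on the left. -/
noncomputable def loopTrans (γ : Path x₀ x₀) (δ : PathsFrom x₀) : PathsFrom x₀ := ofPath (γ.trans δ.toPath)

theorem endpoint_loopTrans (γ : Path x₀ x₀) (δ : PathsFrom x₀) :
    (loopTrans γ δ).1 1 = δ.1 1 := (γ.trans δ.toPath).target

theorem continuous_loopTrans (γ : Path x₀ x₀) : Continuous (loopTrans γ) :=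
  continuous_ofPath <| Path.trans_continuous_family (fun _ : PathsFrom x₀ => γ)
    (γ.continuous.comp continuous_snd) _ continuous_toPath

theorem IsWellEnded.wellTargeted_loopTrans {δ : PathsFrom x₀} (h : IsWellEnded δ.1)
    (γ : Path x₀ x₀) : WellTargeted (loopTrans γ δ) := by
  intro U hU
  have hU' := (continuous_loopTrans γ).continuousAt.preimage_mem_nhds hU
  rw [nhds_induced, mem_comap] at hU'
  obtain ⟨T, hT, hTU⟩ := hU'
  obtain ⟨T', hT'T, hT', hδ⟩ := mem_nhds_iff.1 hT
  obtain ⟨V₀, V₁, -, hV₁, h₀, h₁, hV⟩ := h T' hT' hδ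
  rw [endpoint_loopTrans]
  filter_upwards [hV₁.mem_nhds h₁] with b hb
  obtain ⟨β, hβ, hβ₀, hβ₁⟩ := hV x₀ (δ.2 ▸ h₀) b hb
  exact ⟨loopTrans γ ⟨β, hβ₀⟩, hTU (a := ⟨β, hβ₀⟩) (hT'T hβ), (endpoint_loopTrans _ _).trans hβ₁⟩

theorem IsLocallyWellEnded.locallyWellTargeted_loopTrans {δ : PathsFrom x₀}
    (h : IsLocallyWellEnded δ.1) (γ : Path x₀ x₀) : LocallyWellTargeted (loopTrans γ δ) := by
  intro U hU
  have hU' := (continuous_loopTrans γ).continuousAt.preimage_mem_nhds hU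
  rw [nhds_induced, mem_comap] at hU'
  obtain ⟨T, hT, hTU⟩ := hU'
  obtain ⟨T', hT'T, hT', hδ⟩ := mem_nhds_iff.1 hT
  obtain ⟨V₀, V₁, -, hV₁, h₀, h₁, hV⟩ := h T' hT' hδ
  rw [endpoint_loopTrans]
  filter_upwards [hV₁.mem_nhds h₁] with b hb
  obtain ⟨β, hβ, hβw, hβ₀, hβ₁⟩ := hV x₀ (δ.2 ▸ h₀) b hb
  exact ⟨loopTrans γ ⟨β, hβ₀⟩, hTU (a := ⟨β, hβ₀⟩) (hT'T hβ),
    hβw.wellTargeted_loopTrans (δ := ⟨β, hβ₀⟩) γ, (endpoint_loopTrans _ _).trans hβ₁⟩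

/-- The initial segment of a path, up to time `t`. -/
def initialSegment {x : X} (α : PathsFrom x) (t : I) : Path x (α.1 t) where
  toFun s := α.1 (s * t)
  continuous_toFun := by fun_prop
  source' := by simpa using α.2
  target' := by simp

theorem continuous_initialSegment {x : X} :
    Continuous ↿(fun w : PathsFrom x × I => initialSegment w.1 w.2) := by
  refine (continuous_subtype_val.comp (continuous_fst.comp continuous_fst)).eval ?_
  exact continuous_snd.mul (continuous_snd.comp continuous_fst)

theorem ofPath_trans_initialSegment_one {x y : X} (b : Path x₀ x) (a : Path x y) :
    ofPath (b.trans (initialSegment (ofPath a) 1)) = ofPath (b.trans a) := by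
  obtain ⟨a, ha, rfl⟩ := a
  congr 2
  ext t
  simp [initialSegment, ofPath]
  rfl

namespace SubgroupCover

variable {H : Subgroup (FundamentalGroup X x₀)}

theorem mk_trans_of_forall_eq {x y : X} (b : Path x₀ x) (c : Path x y) (hc : ∀ t, c t = x) :
    mk H (ofPath (b.trans c)) = mk H (ofPath b) := by
  obtain rfl : x = y := (hc 1).symm.trans c.target
  obtain rfl : c = Path.refl x := by ext t; exact hc t
  exact mk_ofPath_eq_of_homotopic (Path.Homotopic.trans_refl b)

/-- If `α` is locally well-ended with the ends of `β`, then `β` is homotopic to the loop `β α⁻¹`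
followed by `α`, and prefixing a loop keeps the path locally well-targeted. -/
theorem exists_locallyWellTargeted (hX : LocallyWepConnected X) (y : SubgroupCover H) :
    ∃ α, LocallyWellTargeted α ∧ mk H α = y := by
  obtain ⟨β, rfl⟩ := isQuotientMap_mk.surjective y
  obtain ⟨α, hα, h₀, h₁⟩ := hX x₀ (β.1 1)
  let a : Path x₀ (β.1 1) := ⟨α, h₀, h₁⟩
  refine ⟨_, hα.locallyWellTargeted_loopTrans (δ := ⟨α, h₀⟩) (β.toPath.trans a.symm), ?_⟩
  have e : loopTrans (β.toPath.trans a.symm) ⟨α, h₀⟩ =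
      ofPath ((β.toPath.trans a.symm).trans a) := by
    refine Subtype.ext (ContinuousMap.ext fun t => ?_)
    change Path.trans _ _ t = Path.trans _ _ t
    rw [Path.trans_apply, Path.trans_apply]
    rfl
  rw [e]
  refine (?_ : _ = mk H (ofPath β.toPath))
  exact mk_ofPath_eq_of_homotopic (((Path.Homotopic.trans_assoc _ _ _).trans
    ((Path.Homotopic.refl _).hcomp (Path.Homotopic.symm_trans _))).trans
      (Path.Homotopic.trans_refl _))

theorem isOpenMap_proj (hX : LocallyWepConnected X) : IsOpenMap (proj H) := by
  refine IsOpenMap.of_nhds_le fun y => ?_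
  obtain ⟨α, hα, rfl⟩ := exists_locallyWellTargeted hX y
  intro U hU
  filter_upwards [hα.wellTargeted _ (isQuotientMap_mk.continuous.continuousAt.preimage_mem_nhds hU)]
  rintro _ ⟨β, hβ, rfl⟩
  exact hβ

/-- The quotient map need not be open, so the open set used consists of the classes having a
well-targeted representative in `W`, close to `α`, with endpoint in `V`. -/
theorem image_mk_mem_nhds (hH : IsOpenSubgroup x₀ H) {α : PathsFrom x₀}
    (hα : LocallyWellTargeted α) {U : Set (PathsFrom x₀)} (hU : U ∈ 𝓝 α) :
    mk H '' U ∈ 𝓝 (mk H α) := by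
  obtain ⟨p₁, h₁, p₂, h₂, hp⟩ := eventually_prod_iff.1 (eventually_mk_eq hH (rfl : mk H α = _))
  obtain ⟨W, hWU, hWo, hαW⟩ := mem_nhds_iff.1 (inter_mem hU (inter_mem h₁ h₂))
  obtain ⟨V, hV, hVo, hαV⟩ := mem_nhds_iff.1 (hα W (hWo.mem_nhds hαW))
  refine mem_nhds_iff.2 ⟨{y | ∃ δ ∈ W, WellTargeted δ ∧ δ.1 1 ∈ V ∧ mk H δ = y}, ?_, ?_, ?_⟩
  · rintro _ ⟨δ, hδ, -, -, rfl⟩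
    exact ⟨δ, (hWU hδ).1, rfl⟩
  · refine isQuotientMap_mk.isOpen_preimage.1 (isOpen_iff_mem_nhds.2 ?_)
    rintro ε ⟨δ, hδ, hδw, hδV, hδε⟩
    have hend : δ.1 1 = ε.1 1 := congrArg (proj H) hδε
    obtain ⟨r₁, k₁, r₂, k₂, hr⟩ := eventually_prod_iff.1 (eventually_mk_eq hH hδε)
    -- For `ε'` near `ε`, this yields `β` in `W` near `δ` ending where `ε'` does, hence equivalent
    -- to `ε'`. As `β` may fail to be well-targeted, it is exchanged below for a well-targeted `β'`
    -- in `W`, equivalent to `β` because both lie close to `α`.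
    have k₃ := hδw _ (inter_mem k₁ (hWo.mem_nhds hδ))
    rw [hend] at k₃ hδV
    filter_upwards [k₂, endpoint.continuous.continuousAt.eventually k₃,
      endpoint.continuous.continuousAt.preimage_mem_nhds (hVo.mem_nhds hδV)] with ε' e₂ e₃ hε'V
    obtain ⟨β, ⟨hβ, hβW⟩, hβε⟩ := e₃
    obtain ⟨β', hβ'W, hβ'w, hβ'ε⟩ := hV hε'V
    have hβ'ε : β'.1 1 = ε'.1 1 := hβ'ε
    have hβε : β.1 1 = ε'.1 1 := hβε
    refine ⟨β', hβ'W, hβ'w, hβ'ε ▸ hε'V, ?_⟩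
    exact (hp (hWU hβ'W).2.1 (hWU hβW).2.2 (hβ'ε.trans hβε.symm)).trans (hr hβ e₂ hβε)
  · obtain ⟨β, hβW, hβw, hβα⟩ := hV hαV
    exact ⟨β, hβW, hβw, hβα ▸ hαV,
      hp (hWU hβW).2.1 (hWU hαW).2.2 hβα⟩

theorem isSeparatedMap_proj (hX : LocallyWepConnected X) (hH : IsOpenSubgroup x₀ H) :
    IsSeparatedMap (proj H) := by
  rw [isSeparatedMap_iff_nhds]
  intro y₁ y₂ hy hne
  obtain ⟨α, hα, rfl⟩ := exists_locallyWellTargeted hX y₁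
  obtain ⟨β, hβ, rfl⟩ := exists_locallyWellTargeted hX y₂
  obtain ⟨p₁, h₁, p₂, h₂, hp⟩ := eventually_prod_iff.1 (eventually_mk_ne hH hy hne)
  refine ⟨_, image_mk_mem_nhds hH hα h₁, _, image_mk_mem_nhds hH hβ h₂, ?_⟩
  rw [disjoint_left]
  rintro _ ⟨δ, hδ, rfl⟩ ⟨ε, hε, h⟩
  exact hp hδ hε h.symm

theorem isLocallyInjective_proj (hX : LocallyWepConnected X) (hH : IsOpenSubgroup x₀ H) :
    IsLocallyInjective (proj H) := by
  rw [isLocallyInjective_iff_nhds]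
  intro y
  obtain ⟨α, hα, rfl⟩ := exists_locallyWellTargeted hX y
  obtain ⟨p₁, h₁, p₂, h₂, hp⟩ := eventually_prod_iff.1 (eventually_mk_eq hH (rfl : mk H α = _))
  refine ⟨_, image_mk_mem_nhds hH hα (inter_mem h₁ h₂), ?_⟩
  rintro _ ⟨δ, hδ, rfl⟩ _ ⟨ε, hε, rfl⟩ h
  exact hp hδ.1 hε.2 h

theorem isLocalHomeomorph_proj (hX : LocallyWepConnected X) (hH : IsOpenSubgroup x₀ H) :
    IsLocalHomeomorph (proj H) := by
  rw [isLocalHomeomorph_iff_isOpenEmbedding_restrict]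
  intro y
  obtain ⟨U, hUo, hy, hU⟩ := isLocallyInjective_proj hX hH y
  exact ⟨U, hUo.mem_nhds hy, .of_continuous_injective_isOpenMap
    ((proj H).continuous.comp continuous_subtype_val) hU.injective
    ((isOpenMap_proj hX).comp hUo.isOpenMap_subtype_val)⟩

/-- The lift of a path starting at the endpoint of `b` to the path of classes of concatenations
of `b` with its initial segments. -/
noncomputable def liftPath (H : Subgroup (FundamentalGroup X x₀)) {x : X} (b : Path x₀ x) :
    C(PathsFrom x, C(I, SubgroupCover H)) :=
  ContinuousMap.curry ⟨fun w => mk H (ofPath (b.trans (initialSegment w.1 w.2))),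
    isQuotientMap_mk.continuous.comp <| continuous_ofPath <|
      Path.trans_continuous_family (fun _ : PathsFrom x × I => b)
        (b.continuous.comp continuous_snd) _ continuous_initialSegment⟩

theorem proj_comp_liftPath {x : X} (b : Path x₀ x) (α : PathsFrom x) :
    (proj H).comp (liftPath H b α) = α.1 :=
  ContinuousMap.ext fun t => (b.trans (initialSegment α t)).target

theorem liftPath_zero {x : X} (b : Path x₀ x) (α : PathsFrom x) :
    liftPath H b α 0 = mk H (ofPath b) :=
  mk_trans_of_forall_eq _ _ fun s => by simpa [initialSegment] using α.2

theorem liftEnds_mk {x y : X} (b : Path x₀ x) (a : Path x y) :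
    LiftEnds (proj H) (mk H (ofPath b)) a.toContinuousMap (mk H (ofPath (b.trans a))) :=
  ⟨liftPath H b (ofPath a), proj_comp_liftPath _ _, liftPath_zero _ _,
    congrArg (mk H) (ofPath_trans_initialSegment_one b a)⟩

theorem hasContinuousPathLifting_proj (hX : LocallyWepConnected X) (hH : IsOpenSubgroup x₀ H) :
    HasContinuousPathLifting (proj H) := by
  intro y
  obtain ⟨β, rfl⟩ := isQuotientMap_mk.surjective y
  rw [isHomeomorph_iff_exists_inverse]
  refine ⟨((ContinuousMap.continuous_postcomp _).comp continuous_subtype_val).subtype_mk _,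
    fun α => ⟨liftPath H β.toPath α, liftPath_zero β.toPath α⟩, fun Γ => Subtype.ext ?_,
    fun α => Subtype.ext (proj_comp_liftPath β.toPath α),
    (liftPath H β.toPath).continuous.subtype_mk _⟩
  -- Lifts along a separated, locally injective map are unique, since `I` is connected.
  refine DFunLike.coe_injective ((isSeparatedMap_proj hX hH).eq_of_comp_eq
    (isLocallyInjective_proj hX hH) (ContinuousMap.continuous _) (ContinuousMap.continuous _) ?_ 0
    ((liftPath_zero β.toPath _).trans Γ.2.symm))
  exact congrArg DFunLike.coe
    (proj_comp_liftPath (H := H) β.toPath (pathsFromMap (proj H) (mk H β) Γ))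

theorem pathConnectedSpace : PathConnectedSpace (SubgroupCover H) := by
  refine pathConnectedSpace_iff_univ.2 ⟨mk H (ofPath (Path.refl x₀)), trivial, fun {y} _ => ?_⟩
  obtain ⟨β, rfl⟩ := isQuotientMap_mk.surjective y
  obtain ⟨Γ, -, h₀, h₁⟩ := liftEnds_mk (H := H) (Path.refl x₀) β.toPath
  refine joinedIn_univ.2 ⟨⟨Γ, h₀, h₁.trans ?_⟩⟩
  exact mk_ofPath_eq_of_homotopic (Path.Homotopic.refl_trans β.toPath)

theorem isConnectedSemicovering_proj (hX : LocallyWepConnected X) (hH : IsOpenSubgroup x₀ H) :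
    IsConnectedSemicovering (proj H) where
  isLocalHomeomorph := isLocalHomeomorph_proj hX hH
  pathLifting := hasContinuousPathLifting_proj hX hH
  homotopyLifting := (hasContinuousPathLifting_proj hX hH).hasContinuousHomotopyLifting
  pathConnected := pathConnectedSpace

end SubgroupCover

end SubgroupCover

/-! ### Morphisms of semicoverings and conjugation of subgroups. -/

section Universal

variable {X : Type*} [TopologicalSpace X] {x₀ : X}

theorem IsConnectedSemicovering.exists_fiber {Y : Type*} [TopologicalSpace Y] {q : C(Y, X)}
    (hq : IsConnectedSemicovering q) (hX : LocallyWepConnected X) (x : X) : ∃ y, q y = x := by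
  obtain ⟨y⟩ := hq.pathConnected.nonempty
  obtain ⟨α, -, h₀, h₁⟩ := hX (q y) x
  obtain ⟨w, hw, -⟩ := hq.pathLifting.exists_liftEnds rfl ⟨α, h₀, h₁⟩
  exact ⟨w, hw⟩

open SubgroupCover in
theorem exists_conj_mem_of_hom (hX : LocallyWepConnected X) {H : Subgroup (FundamentalGroup X x₀)}
    (hH : IsOpenSubgroup x₀ H) {Y : Type*} [TopologicalSpace Y] {p : C(Y, X)}
    (hp : IsSemicovering p) {y : Y} (hy : p y = x₀) {f : C(Y, SubgroupCover H)}
    (hf : (proj H).comp f = p) :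
    ∃ g, ∀ s ∈ liftStabilizer hp hy, g * s * g⁻¹ ∈ H := by
  obtain ⟨β, hβ⟩ := isQuotientMap_mk.surjective (f y)
  have hβx : β.1 1 = x₀ :=
    (congrArg (proj H) hβ).trans ((DFunLike.congr_fun hf y).trans hy)
  let b : Path x₀ x₀ := ⟨β.1, β.2, hβx⟩
  -- Multiplication of classes reverses concatenation, so the loop `b γ b⁻¹` has class `[b]⁻¹ [γ]
  -- [b]`.
  refine ⟨(loopClass x₀ b)⁻¹, ?_⟩
  rintro _ ⟨γ, rfl, hγ⟩
  have h₁ := hγ.comp hf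
  rw [← hβ] at h₁
  have h₂ := (liftEnds_mk (H := H) b γ).unique (hasContinuousPathLifting_proj hX hH) h₁
  have h₃ := (mk_ofPath_eq_iff (b := b)).1 h₂
  rw [loopClass_trans, loopClass_trans, loopClass_symm] at h₃
  rwa [inv_inv, mul_assoc]

open SubgroupCover in
-- Moving the base point from `z` along the lift of a loop of class `g⁻¹` to `w` undoes the
-- conjugation: loops with class in `S` lift to loops at `w`. Hence the endpoint of the lift of a
-- path from `w` depends only on its class.
theorem exists_hom_of_conj_mem {S : Subgroup (FundamentalGroup X x₀)} {Z : Type*}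
    [TopologicalSpace Z] {q : C(Z, X)} (hq : IsSemicovering q) {z : Z} (hz : q z = x₀)
    (g : FundamentalGroup X x₀) (hg : ∀ s ∈ S, g * s * g⁻¹ ∈ liftStabilizer hq hz) :
    ∃ f : C(SubgroupCover S, Z), q.comp f = proj S := by
  obtain ⟨δ, hδ⟩ := loopClass_surjective g⁻¹
  obtain ⟨w, hw, hzw⟩ := hq.pathLifting.exists_liftEnds hz δ
  obtain ⟨L, hL⟩ := hq.pathLifting.exists_lift hw
  have hend (α : PathsFrom x₀) : LiftEnds q w α.1 (L α 1) := ⟨L α, (hL α).1, (hL α).2, rfl⟩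
  let F : C(PathsFrom x₀, Z) := ⟨fun α => L α 1, L.continuous.eval_const 1⟩
  have hF (α β : PathsFrom x₀) (h : (coverSetoid S).r α β) : F α = F β := by
    obtain ⟨h, hS⟩ := h
    have hmem := hg _ hS
    rw [← inv_inv g, ← hδ, inv_inv, ← loopClass_symm, mul_assoc, ← loopClass_trans,
      ← loopClass_trans, loopClass_mem_liftStabilizer] at hmem
    obtain ⟨v, -, hv⟩ := hq.pathLifting.exists_liftEnds hw
      (α.toPath.trans (β.toPath.cast rfl h).symm)
    obtain rfl := hmem.eq_of_trans_symm hq.pathLifting (hzw.trans hv) hzw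
    exact hv.eq_of_trans_symm (b := β.toPath.cast rfl h) hq.pathLifting (hend α) (hend β)
  refine ⟨⟨Quotient.lift F hF, F.continuous.quotient_lift hF⟩, ContinuousMap.ext fun y => ?_⟩
  obtain ⟨α, rfl⟩ := isQuotientMap_mk.surjective y
  exact DFunLike.congr_fun (hL α).1 1

end Universal

end Semicov

theorem mainTheorem7 {X : Type*} [TopologicalSpace X]
    (hX : Semicov.LocallyWepConnected X) (x₀ : X) :
    Semicov.HasUniversalSemicovering X ↔
      ∃ S : Subgroup (FundamentalGroup X x₀), Semicov.IsOpenSubgroup x₀ S ∧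
        ∀ H : Subgroup (FundamentalGroup X x₀), Semicov.IsOpenSubgroup x₀ H →
          ∃ g : FundamentalGroup X x₀, ∀ s ∈ S, g * s * g⁻¹ ∈ H := by
  constructor
  · rintro ⟨Y, _, p, hp⟩
    obtain ⟨y, hy⟩ := hp.toIsConnectedSemicovering.exists_fiber hX x₀
    refine ⟨Semicov.liftStabilizer hp.toIsSemicovering hy,
      Semicov.isOpenSubgroup_liftStabilizer _ hy, fun H hH => ?_⟩
    obtain ⟨f, hf⟩ := hp.exists_hom (Semicov.SubgroupCover H) (Semicov.SubgroupCover.proj H)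
      (Semicov.SubgroupCover.isConnectedSemicovering_proj hX hH)
    exact Semicov.exists_conj_mem_of_hom hX hH hp.toIsSemicovering hy hf
  · rintro ⟨S, hS, hconj⟩
    refine ⟨Semicov.SubgroupCover S, inferInstance, Semicov.SubgroupCover.proj S,
      Semicov.SubgroupCover.isConnectedSemicovering_proj hX hS, fun Z _ q hq => ?_⟩
    obtain ⟨z, hz⟩ := hq.exists_fiber hX x₀
    obtain ⟨g, hg⟩ := hconj _ (Semicov.isOpenSubgroup_liftStabilizer hq.toIsSemicovering hz)
    exact Semicov.exists_hom_of_conj_mem hq.toIsSemicovering hz g hg
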